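/- A permutation $\tau\in S_n$ contains $\pi\in S_k$ if some subsequence of $\tau$ has the same relative order as $\pi$; $\mathrm{Av}(\rho)$ is the set of permutations not containing $\rho$. Permutations are viewed as finite point sets with no two points in the same row or column, up to order isomorphism. An *increase* is a pair of points, the second one to the right of and above the first. A set $A$ of points is *sandwiched from below* by an increase $q$ if $A$ is above $q$ and every point of $A$ lies horizontally strictly between the two points of $q$; it is *sandwiched from the left* (*from the right*) by $q$ if $A$ is to the right (left) of $q$ and every point of $A$ lies vertically strictly between the two points of $q$. A *staircase* of $K$ steps is a sequence $(q_1,p_1,\dots,q_K,p_K)$ of disjoint increases (the *bends*; $q_m$ is the $m$th outer and $p_m$ the $m$th inner bend, and $q_1$ is the *base*) such that $p_m$ is sandwiched from the left by $q_m$; $q_{m+1}$ is sandwiched from below by $p_m$; $q_{m+1}$ is to the right of and above $q_m$; and $p_{m+1}$ is to the right of and above $p_m$. An *$r$-fold staircase* is a tuple $(S_1,\dots,S_r)$ of disjoint staircases of $K$ steps such that for $S=(q_m,p_m)_m$ preceding $S'=(q'_m,p'_m)_m$ in the tuple, for all $m$: $q'_m$ is above and to the right of $q_m$ and to the left of $p_m$;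 $p'_m$ is above and to the right of $p_m$; and, for $m<K$, $p'_m$ is below $q_{m+1}$, $p'_m$ is below and to the left of $p_{m+1}$, and $q'_m$ is below and to the left of $q_{m+1}$. Its $m$th outer (inner) bend is the union of those of the $S_i$, and its base is its first outer bend. Let $\Phi$ be a 3-CNF formula with variables $x_1,\dots,x_v$ and clauses $K_1,\dots,K_c$, each clause being a disjunction of three literals with three distinct variables. Let $M\ge 1$ be the integer specified below. **Pattern.** $\pi=\pi(\Phi)$ is the disjoint union of a $v$-fold staircase $X=(X_1,\dots,X_v)$ of $2c+1$ steps and an increasing sequence of length $M$ (the *anchor*) that is below $X$, to the right of the base of $X$ and to the left of the first inner bend of $X$. **Text.** Start with a $2v$-fold staircase $Y=(X^{T}_1,X^{F}_1,\dots,X^{T}_v,X^{F}_v)$ of $2c+1$ steps together with an anchor of length $M$ placed in the same way with respect to $Y$. For each $i$ exchange the horizontal positions of the bases of $X^T_i$ and $X^F_i$, so that these four points, which form $1234$, come to form $3412$ while occupying the same four rows and the same four columns. Then for each $t\in\{1,\dots,c\}$ modify the steps $2t$ and $2t+1$ as follows. Let $K_t$ contain literals $L_i,L_j,L_k$ of $x_i,x_j,x_k$,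 $i<j<k$. For $h\in\{i,j,k\}$ let $X_h^+\in\{X^T_h,X^F_h\}$ be the staircase of the literal $L_h$ ($X^T_h$ if $L_h=x_h$, $X^F_h$ if $L_h=\lnot x_h$) and $X_h^-$ the other one. The staircases that receive a *bypass* are $X_j^-$ and all $X^T_h,X^F_h$ with $i<h<j$ or $j<h<k$. If $q_{2t},p_{2t},q_{2t+1}$ are the bends of such a staircase, its bypass consists of three new increases $q'_{2t},p'_{2t},q'_{2t+1}$ such that replacing $q_{2t},p_{2t},q_{2t+1}$ by $q'_{2t},p'_{2t},q'_{2t+1}$ again gives a staircase, $q_{2t}$ is above and to the left of $q'_{2t}$, $p_{2t}$ is above and to the right of $p'_{2t}$, and $q'_{2t+1}$ is sandwiched by $q_{2t+1}$ from the right. The points are arranged as follows. * The $2t$th outer bends of all the staircases and bypasses form three increasing sequences, the top one above the middle one and the middle one above the bottom one. From left to right, they consist of - top: $X_j^-$; $X^T_h,X^F_h$ for $h=j+1,\dots,k-1$; $X_k^+$; $X^T_h,X^F_h$ for $h=k+1,\dots,v$; - middle: $X_i^-$; $X^T_h,X^F_h$ for $h=i+1,\dots,j-1$; $X_j^+$;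 the bypasses of $X^T_h,X^F_h$ for $h=j+1,\dots,k-1$; $X_k^-$; - bottom: $X^T_h,X^F_h$ for $h=1,\dots,i-1$; $X_i^+$; the bypasses of $X^T_h,X^F_h$ for $h=i+1,\dots,j-1$; the bypass of $X_j^-$. Their horizontal positions are those determined by the (unmodified) $(2t-1)$st inner bends, which sandwich them from below. * The $2t$th inner bends of all the staircases and bypasses form one increasing sequence; their vertical order is determined by the $2t$th outer bends, which sandwich them from the left. * The horizontal order of the $(2t+1)$st outer bends is determined by the $2t$th inner bends, which sandwich them from below, and their vertical order by the (unmodified) $(2t+1)$st inner bends. All other relative positions are as in $Y$: a new or moved point lies, with respect to the points of all bends of other indices (and the anchor) not mentioned above, like the bend of the same index of $Y$. The result is $\tau=\tau(\Phi)$. Finally, $M=N+1$, where $N$ is the number of points of $\tau$ not in its anchor. **Proposition.** For every such $\Phi$ (with any $v,c\ge 0$), $\pi(\Phi)\in\mathrm{Av}(321)$, $\tau(\Phi)\in\mathrm{Av}(4321)$, and $\Phi$ is satisfiable if and only if $\tau(\Phi)$ contains $\pi(\Phi)$. -/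

import Mathlib

namespace PermPattern

/-! ### Permutations and pattern containment -/

/-- `τ` contains `π`: some subsequence of `τ` has the same relative order as `π`. -/
def Contains {k n : ℕ} (τ : Equiv.Perm (Fin n)) (π : Equiv.Perm (Fin k)) : Prop :=
  ∃ f : Fin k ↪o Fin n, ∀ a b : Fin k, τ (f a) < τ (f b) ↔ π a < π b

/-- `σ ∈ Av(ρ)`. -/
def Avoids {k n : ℕ} (σ : Equiv.Perm (Fin n)) (ρ : Equiv.Perm (Fin k)) : Prop :=
  ¬ Contains σ ρ

/-- The decreasing permutation `k (k-1) … 1`. -/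
def decreasing (k : ℕ) : Equiv.Perm (Fin k) := Fin.revPerm

/-- The numbering `0, 1, 2, …` of the elements of a finite set by increasing value of an injective
coordinate `x`. -/
noncomputable def rankEquiv {P α : Type} [Fintype P] [LinearOrder α] (x : P → α)
    (hx : Function.Injective x) : P ≃ Fin (Fintype.card P) :=
  letI : LinearOrder P := LinearOrder.lift' x hx
  (Fintype.orderIsoFinOfCardEq P rfl).symm.toEquiv

theorem rankEquiv_lt_iff {P α : Type} [Fintype P] [LinearOrder α] (x : P → α)
    (hx : Function.Injective x) (p q : P) :
    rankEquiv x hx p < rankEquiv x hx q ↔ x p < x q := by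
  let _ : LinearOrder P := LinearOrder.lift' x hx
  exact (Fintype.orderIsoFinOfCardEq P rfl).symm.lt_iff_lt

/-- The permutation drawn by a finite set of points, no two in the same column (`x`) or in the same
row (`y`): the `a`-th point from the left is sent to its rank from the bottom. -/
noncomputable def permOfPoints {P α β : Type} [Fintype P] [LinearOrder α] [LinearOrder β]
    (x : P → α) (y : P → β) (hx : Function.Injective x) (hy : Function.Injective y) :
    Equiv.Perm (Fin (Fintype.card P)) :=
  (rankEquiv x hx).symm.trans (rankEquiv y hy)

/-! ### 3-CNF formulas -/

/-- A clause `L_i ∨ L_j ∨ L_k` on three distinct variables, listed in increasing order. The sign of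
a literal is `true` for `x` and `false` for `¬ x`. -/
structure Clause (v : ℕ) where
  i : Fin v
  j : Fin v
  k : Fin v
  i_lt_j : i < j
  j_lt_k : j < k
  signI : Bool
  signJ : Bool
  signK : Bool

/-- A 3-CNF formula with `v` variables and `c` clauses. -/
abbrev Formula (v c : ℕ) := Fin c → Clause v

def Clause.Holds {v : ℕ} (K : Clause v) (φ : Fin v → Bool) : Prop :=
  φ K.i = K.signI ∨ φ K.j = K.signJ ∨ φ K.k = K.signK

def Satisfiable {v c : ℕ} (Φ : Formula v c) : Prop :=
  ∃ φ : Fin v → Bool, ∀ t : Fin c, (Φ t).Holds φ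

/-! ### Steps and bends of the staircases -/

/-- The `2c+1` steps of a staircase. Step number `1` is the base step; the clause `t`
(where `t = 0, …, c-1`) owns the two steps numbered `2(t+1)` and `2(t+1)+1`. -/
inductive Step (c : ℕ) where
  | base : Step c
  | fork (t : Fin c) : Step c
  | merge (t : Fin c) : Step c
  deriving DecidableEq, Fintype

/-- The number of a step, from `1` to `2c+1`. -/
def Step.num {c : ℕ} : Step c → ℕ
  | .base => 1
  | .fork t => 2 * (t + 1)
  | .merge t => 2 * (t + 1) + 1

/-- Every step `m` has an outer bend `q_m` and an inner bend `p_m`. -/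
inductive Side where
  | outer : Side
  | inner : Side
  deriving DecidableEq

instance : Fintype Side := ⟨{.outer, .inner}, fun x => by cases x <;> simp⟩

/-- A bend either belongs to the original staircase or to a bypass of it. -/
inductive Copy where
  | main : Copy
  | bypass : Copy
  deriving DecidableEq

instance : Fintype Copy := ⟨{.main, .bypass}, fun x => by cases x <;> simp⟩

/-- A bend is an increase: it has a lower left element and an upper right element. -/
inductive Corner where
  | lo : Corner
  | hi : Corner
  deriving DecidableEq

instance : Fintype Corner := ⟨{.lo, .hi}, fun x => by cases x <;> simp⟩

/-- Coordinates, compared lexicographically: the block of columns (or rows) of the drawing, the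
level inside the block, the number of the staircase inside the level, and a slot inside the group of
elements of that staircase. -/
abbrev Coord := ℕ ×ₗ ℕ ×ₗ ℕ ×ₗ ℕ

def coord (block level stair slot : ℕ) : Coord :=
  toLex (block, toLex (level, toLex (stair, slot)))

/-- The outer bend `q_{m+1}` lies in the same columns as the inner bend `p_m` and is sandwiched by it
from below; in a fork, `q_{m+1}` is left of the bend `q'_{m+1}` of the bypass, and both are
sandwiched by `p_m`. So the left-to-right order is
`p_m lo, q_{m+1} lo, q_{m+1} hi, q'_{m+1} lo, q'_{m+1} hi, p_m hi`. -/
def columnSlot : Side → Copy → Corner → ℕ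
  | .inner, _, .lo => 0
  | .outer, .main, .lo => 1
  | .outer, .main, .hi => 2
  | .outer, .bypass, .lo => 3
  | .outer, .bypass, .hi => 4
  | .inner, _, .hi => 5

/-- The inner bend `p_m` lies in the same rows as the outer bend `q_m` and is sandwiched by it from
the left; in a merge, the bend `q'_m` of the bypass is sandwiched by `q_m` from the right, and `p_m`
is sandwiched from the left by both. So the bottom-to-top order is
`q_m lo, q'_m lo, p_m lo, p_m hi, q'_m hi, q_m hi`. -/
def rowSlot : Side → Copy → Corner → ℕ
  | .outer, .main, .lo => 0
  | .outer, .bypass, .lo => 1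
  | .inner, _, .lo => 2
  | .inner, _, .hi => 3
  | .outer, .bypass, .hi => 4
  | .outer, .main, .hi => 5

/-- The blocks of columns, from left to right: block `0` is the base, block `1` is the anchor, and
block `m + 1` consists of the `m`-th inner bend and the `(m+1)`-st outer bend. -/
def columnBlock {c : ℕ} : Step c → Side → ℕ
  | .base, .outer => 0
  | .fork t, .outer => (Step.fork t).num
  | .merge t, .outer => (Step.merge t).num
  | m, .inner => m.num + 1

/-! ### The pattern -/

/-- An element of the `v`-fold staircase `X` with `2c+1` steps. -/
structure XElement (v c : ℕ) where
  var : Fin v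
  step : Step c
  side : Side
  corner : Corner
  deriving DecidableEq, Fintype

def XElement.column {v c : ℕ} (e : XElement v c) : Coord :=
  coord (columnBlock e.step e.side) 0 e.var (columnSlot e.side .main e.corner)

/-- Row block `m` consists of the `m`-th outer and the `m`-th inner bend. -/
def XElement.row {v c : ℕ} (e : XElement v c) : Coord :=
  coord e.step.num 0 e.var (rowSlot e.side .main e.corner)

/-- An anchor is an increasing sequence below everything else, to the right of the base and to the
left of the first inner bend. -/
def anchorColumn {M : ℕ} (a : Fin M) : Coord := coord 1 0 a 0

def anchorRow {M : ℕ} (a : Fin M) : Coord := coord 0 0 a 0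

/-- The elements of the pattern with an anchor of length `M`. -/
abbrev PatternElement (v c M : ℕ) := XElement v c ⊕ Fin M

def patternColumn {v c M : ℕ} : PatternElement v c M → Coord :=
  Sum.elim XElement.column anchorColumn

def patternRow {v c M : ℕ} : PatternElement v c M → Coord :=
  Sum.elim XElement.row anchorRow

/-! ### The text -/

/-- A literal, which is also the name of the staircase `X^T_i` (for `(i, true)`) or `X^F_i`
(for `(i, false)`) representing it. -/
abbrev Literal (v : ℕ) := Fin v × Bool

/-- The position in the list `X^T_1, X^F_1, X^T_2, X^F_2, …, X^T_v, X^F_v`. -/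
def Literal.index {v : ℕ} (s : Literal v) : ℕ := 2 * s.1 + if s.2 then 0 else 1

/-- The left-to-right position of the base of a staircase: `X^F_1, X^T_1, X^F_2, X^T_2, …`. As the
rows of the bases follow `Literal.index`, the bases of `X^T_i` and `X^F_i` form a `3412`. -/
def Literal.baseIndex {v : ℕ} (s : Literal v) : ℕ := 2 * s.1 + if s.2 then 1 else 0

/-- The staircases that get a bypass at the clause `K`. -/
def Clause.Bypassed {v : ℕ} (K : Clause v) (s : Literal v) : Prop :=
  (K.i < s.1 ∧ s.1 < K.j) ∨ (s.1 = K.j ∧ s.2 ≠ K.signJ) ∨ (K.j < s.1 ∧ s.1 < K.k)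

instance {v : ℕ} (K : Clause v) (s : Literal v) : Decidable (K.Bypassed s) := by
  unfold Clause.Bypassed; infer_instance

/-- The level (`0` bottom, `1` middle, `2` top) of the bend of the staircase `s`, or of the bend of
its bypass, in the fork gadget of the clause `K`. -/
def Clause.level {v : ℕ} (K : Clause v) (s : Literal v) : Copy → ℕ
  | .main =>
      if s.1 < K.i then 0
      else if s.1 = K.i then (if s.2 = K.signI then 0 else 1)
      else if s.1 < K.j then 1
      else if s.1 = K.j then (if s.2 = K.signJ then 1 else 2)
      else if s.1 = K.k then (if s.2 = K.signK then 2 else 1)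
      else 2
  | .bypass => if s.1 ≤ K.j then 0 else 1

/-- An element of the `2v`-fold staircase `Y`, or a possible element of a bypass. -/
structure Candidate (v c : ℕ) where
  lit : Literal v
  step : Step c
  side : Side
  copy : Copy
  corner : Corner
  deriving DecidableEq, Fintype

/-- A bypass at the clause `t` consists of two outer bends and the inner bend between them. -/
def onBypass {c : ℕ} : Step c → Side → Option (Fin c)
  | .fork t, _ => some t
  | .merge t, .outer => some t
  | _, _ => none

/-- All elements of `Y` are present; of the others, those on the bypasses are. -/
def Candidate.Present {v c : ℕ} (Φ : Formula v c) (e : Candidate v c) : Prop :=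
  e.copy = .main ∨ ∃ t ∈ onBypass e.step e.side, (Φ t).Bypassed e.lit

instance {v c : ℕ} (Φ : Formula v c) : DecidablePred (Candidate.Present Φ) := fun e => by
  unfold Candidate.Present; infer_instance

/-- The text without its anchor. -/
abbrev YElement {v c : ℕ} (Φ : Formula v c) := {e : Candidate v c // e.Present Φ}

/-- The level inside the row block of a step. At the steps `2(t+1)` these are the levels of the fork
gadget; elsewhere there is only one level. -/
def rowLevel {v c : ℕ} (Φ : Formula v c) (s : Literal v) (r : Copy) : Step c → ℕ
  | .fork t => (Φ t).level s r
  | _ => 0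

/-- The level inside a column block. The inner bends of a step form an increasing sequence, so they
follow the order of their rows, and an outer bend sandwiched by an inner bend shares its level. -/
def columnLevel {v c : ℕ} (Φ : Formula v c) (s : Literal v) (r : Copy) : Step c → Side → ℕ
  | .merge t, .outer => (Φ t).level s r
  | _, .outer => 0
  | m, .inner => rowLevel Φ s r m

/-- The number of a staircase for the columns of a bend. -/
def columnStair {v c : ℕ} (s : Literal v) : Step c → Side → ℕ
  | .base, .outer => s.baseIndex
  | _, _ => s.index

def Candidate.column {v c : ℕ} (Φ : Formula v c) (e : Candidate v c) : Coord :=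
  coord (columnBlock e.step e.side) (columnLevel Φ e.lit e.copy e.step e.side)
    (columnStair e.lit e.step e.side) (columnSlot e.side e.copy e.corner)

def Candidate.row {v c : ℕ} (Φ : Formula v c) (e : Candidate v c) : Coord :=
  coord e.step.num (rowLevel Φ e.lit e.copy e.step) e.lit.index (rowSlot e.side e.copy e.corner)

/-- The length `M` of the two anchors: one more than the number of the other elements of the
text. -/
def anchorLength {v c : ℕ} (Φ : Formula v c) : ℕ := Fintype.card (YElement Φ) + 1

/-- The elements of the text. -/
abbrev TextElement {v c : ℕ} (Φ : Formula v c) := YElement Φ ⊕ Fin (anchorLength Φ)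

def textColumn {v c : ℕ} (Φ : Formula v c) : TextElement Φ → Coord :=
  Sum.elim (fun e => e.1.column Φ) anchorColumn

def textRow {v c : ℕ} (Φ : Formula v c) : TextElement Φ → Coord :=
  Sum.elim (fun e => e.1.row Φ) anchorRow

/-! ### No two elements share a column or a row -/

theorem coord_inj {a b c d a' b' c' d' : ℕ} :
    coord a b c d = coord a' b' c' d' ↔ a = a' ∧ b = b' ∧ c = c' ∧ d = d' := by
  simp [coord]

theorem Step.num_injective {c : ℕ} : Function.Injective (Step.num (c := c)) := by
  intro a b h
  cases a <;> cases b <;> simp only [Step.num] at h <;>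
    first
    | rfl
    | (exfalso; omega)
    | (congr 1; apply Fin.ext; omega)

theorem Literal.index_injective {v : ℕ} : Function.Injective (Literal.index (v := v)) := by
  rintro ⟨i, a⟩ ⟨j, b⟩ h
  simp only [Literal.index] at h
  cases a <;> cases b <;> simp at h <;> simp [Fin.ext_iff] <;> omega

theorem Literal.baseIndex_injective {v : ℕ} :
    Function.Injective (Literal.baseIndex (v := v)) := by
  rintro ⟨i, a⟩ ⟨j, b⟩ h
  simp only [Literal.baseIndex] at h
  cases a <;> cases b <;> simp at h <;> simp [Fin.ext_iff] <;> omega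

theorem Clause.level_ne {v : ℕ} (K : Clause v) (s : Literal v) (h : K.Bypassed s) :
    K.level s .main ≠ K.level s .bypass := by
  have h1 := K.i_lt_j
  have h2 := K.j_lt_k
  obtain ⟨x, b⟩ := s
  simp only [Clause.Bypassed, Clause.level, Fin.lt_def, Fin.le_def, Fin.ext_iff] at *
  split_ifs <;> simp_all <;> omega

theorem patternColumn_injective {v c M : ℕ} :
    Function.Injective (patternColumn (v := v) (c := c) (M := M)) := by
  rintro (⟨i, m, p, e⟩ | a) (⟨i', m', p', e'⟩ | a') h <;>
    simp only [patternColumn, Sum.elim_inl, Sum.elim_inr, XElement.column, anchorColumn,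
      coord_inj] at h
  · obtain ⟨h1, -, h2, h3⟩ := h
    obtain rfl : i = i' := Fin.ext h2
    have hp : p = p' ∧ e = e' := by
      cases p <;> cases p' <;> cases e <;> cases e' <;> simp [columnSlot] at h3 ⊢
    obtain ⟨rfl, rfl⟩ := hp
    have hm : m = m' := by
      apply Step.num_injective
      cases p <;> cases m <;> cases m' <;> simp [columnBlock, Step.num] at h1 ⊢ <;> omega
    rw [hm]
  · exfalso
    cases p <;> cases m <;> simp [columnBlock, Step.num] at h <;> omega
  · exfalso
    cases p' <;> cases m' <;> simp [columnBlock, Step.num] at h <;> omega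
  · exact congrArg Sum.inr (Fin.ext h.2.2.1)

theorem patternRow_injective {v c M : ℕ} :
    Function.Injective (patternRow (v := v) (c := c) (M := M)) := by
  rintro (⟨i, m, p, e⟩ | a) (⟨i', m', p', e'⟩ | a') h <;>
    simp only [patternRow, Sum.elim_inl, Sum.elim_inr, XElement.row, anchorRow, coord_inj] at h
  · obtain ⟨h1, -, h2, h3⟩ := h
    obtain rfl : i = i' := Fin.ext h2
    obtain rfl := Step.num_injective h1
    have hp : p = p' ∧ e = e' := by
      cases p <;> cases p' <;> cases e <;> cases e' <;> simp [rowSlot] at h3 ⊢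
    obtain ⟨rfl, rfl⟩ := hp
    rfl
  · exfalso
    cases m <;> simp [Step.num] at h
  · exfalso
    cases m' <;> simp [Step.num] at h
  · exact congrArg Sum.inr (Fin.ext h.2.2.1)

theorem inner_copy_unique {v c : ℕ} {Φ : Formula v c} {s : Literal v} {m : Step c} {r r' : Copy}
    {e e' : Corner} (h : Candidate.Present Φ ⟨s, m, .inner, r, e⟩)
    (h' : Candidate.Present Φ ⟨s, m, .inner, r', e'⟩)
    (hl : rowLevel Φ s r m = rowLevel Φ s r' m) : r = r' := by
  cases r <;> cases r' <;> first | rfl | skip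
  all_goals
    cases m <;> simp [Candidate.Present, onBypass] at h h'
    simp only [rowLevel] at hl
  · exact absurd hl (Clause.level_ne _ _ h')
  · exact absurd hl.symm (Clause.level_ne _ _ h)

theorem textColumn_injective {v c : ℕ} (Φ : Formula v c) :
    Function.Injective (textColumn Φ) := by
  rintro (⟨⟨s, m, p, r, e⟩, hP⟩ | a) (⟨⟨s', m', p', r', e'⟩, hP'⟩ | a') h <;>
    simp only [textColumn, Sum.elim_inl, Sum.elim_inr, Candidate.column, anchorColumn,
      coord_inj] at h
  · obtain ⟨h1, h4, h2, h3⟩ := h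
    have hp : p = p' ∧ e = e' ∧ (p = .outer → r = r') := by
      cases p <;> cases p' <;> cases e <;> cases e' <;> cases r <;> cases r' <;>
        simp [columnSlot] at h3 ⊢
    obtain ⟨rfl, rfl, hr⟩ := hp
    have hm : m = m' := by
      apply Step.num_injective
      cases p <;> cases m <;> cases m' <;> simp [columnBlock, Step.num] at h1 ⊢ <;> omega
    subst hm
    have hs : s = s' := by
      cases m <;> cases p <;> first
        | exact Literal.index_injective h2
        | exact Literal.baseIndex_injective h2
    subst hs
    have hrr : r = r' := by
      cases p
      · exact hr rfl
      · refine inner_copy_unique hP hP' ?_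
        cases m <;> simpa [columnLevel] using h4
    subst hrr
    rfl
  · exfalso
    cases p <;> cases m <;> simp [columnBlock, Step.num] at h <;> omega
  · exfalso
    cases p' <;> cases m' <;> simp [columnBlock, Step.num] at h <;> omega
  · exact congrArg Sum.inr (Fin.ext h.2.2.1)

theorem textRow_injective {v c : ℕ} (Φ : Formula v c) : Function.Injective (textRow Φ) := by
  rintro (⟨⟨s, m, p, r, e⟩, hP⟩ | a) (⟨⟨s', m', p', r', e'⟩, hP'⟩ | a') h <;>
    simp only [textRow, Sum.elim_inl, Sum.elim_inr, Candidate.row, anchorRow, coord_inj] at h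
  · obtain ⟨h1, h4, h2, h3⟩ := h
    obtain rfl := Step.num_injective h1
    obtain rfl := Literal.index_injective h2
    have hp : p = p' ∧ e = e' ∧ (p = .outer → r = r') := by
      cases p <;> cases p' <;> cases e <;> cases e' <;> cases r <;> cases r' <;>
        simp [rowSlot] at h3 ⊢
    obtain ⟨rfl, rfl, hr⟩ := hp
    have hrr : r = r' := by
      cases p
      · exact hr rfl
      · exact inner_copy_unique hP hP' h4
    subst hrr
    rfl
  · exfalso
    cases m <;> simp [Step.num] at h
  · exfalso
    cases m' <;> simp [Step.num] at h
  · exact congrArg Sum.inr (Fin.ext h.2.2.1)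

/-! ### The two permutations -/

/-- The pattern `π(Φ)`. -/
noncomputable def pattern {v c : ℕ} (Φ : Formula v c) :
    Equiv.Perm (Fin (Fintype.card (PatternElement v c (anchorLength Φ)))) :=
  permOfPoints patternColumn patternRow patternColumn_injective patternRow_injective

/-- The text `τ(Φ)`. -/
noncomputable def text {v c : ℕ} (Φ : Formula v c) :
    Equiv.Perm (Fin (Fintype.card (TextElement Φ))) :=
  permOfPoints (textColumn Φ) (textRow Φ) (textColumn_injective Φ) (textRow_injective Φ)

end PermPattern

/-!
In the pattern the outer bends form an increasing sequence, and so do the anchor and the inner bends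
together; hence there is no `321`. In the text, too, the anchor and the inner bends form an increasing
sequence. The outer bends of the text contain no `321`: a descent among them stays within one step; at
the base it exchanges the two staircases of a variable, and at a clause it changes the level, where no
bend can be the middle of a descent through all three levels (`Clause.not_three_levels`). So the text
has no `4321`.

An assignment chooses one staircase per variable. The chosen staircases, each possibly led through
its bypass at a clause, form a multiple staircase exactly if at every clause their levels in the
fork gadget are nondecreasing. Such a choice of bypasses exists if and only if the clause holds
(`Clause.Holds.exists_copy`, `Clause.holds_of_monotone`), which gives an occurrence of the pattern
for each satisfying assignment.

Conversely, in any occurrence some element of the anchor of the pattern goes to the anchor of the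
text, since the rest of the text is too small. Then the base of the pattern goes to the base of the
text. There an increasing sequence has at most two elements among the four of a variable, and two
only if they are the elements of one bend, so it contains exactly one of the two bases of every
variable, and this defines an assignment (`exists_assignment`). An outer bend of the text sandwiches
from the left nothing but the inner bend of its step, and an inner bend sandwiches from below nothing
but the next outer bends of its staircase, so every staircase of the occurrence follows the one it
starts in, up to the choice of bypasses (`inner_of_outer`, `outer_of_inner`). The rows of the fork
gadgets then show that the levels are nondecreasing, hence that every clause holds.
-/

namespace PermPattern

/-! ### Permutations drawn by point sets -/

theorem contains_permOfPoints_of_lt {P Q α β γ δ : Type} [Fintype P] [Fintype Q]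
    [LinearOrder α] [LinearOrder β] [LinearOrder γ] [LinearOrder δ]
    {x : P → α} {y : P → β} (hx : Function.Injective x) (hy : Function.Injective y)
    {x' : Q → γ} {y' : Q → δ} (hx' : Function.Injective x') (hy' : Function.Injective y')
    (g : P → Q) (hgx : ∀ p q, x p < x q → x' (g p) < x' (g q))
    (hgy : ∀ p q, y p < y q → y' (g p) < y' (g q)) :
    Contains (permOfPoints x' y' hx' hy') (permOfPoints x y hx hy) := by
  have hgy' : ∀ p q, y' (g p) < y' (g q) ↔ y p < y q := by
    refine fun p q => ⟨fun h => ?_, hgy p q⟩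
    rcases lt_trichotomy (y p) (y q) with h1 | h1 | h1
    · exact h1
    · rw [hy h1] at h
      exact absurd h (lt_irrefl _)
    · exact absurd h (hgy _ _ h1).asymm
  refine ⟨OrderEmbedding.ofStrictMono
    (fun a => rankEquiv x' hx' (g ((rankEquiv x hx).symm a))) fun a b hab => ?_, fun a b => ?_⟩
  · rw [rankEquiv_lt_iff]
    apply hgx
    rw [← rankEquiv_lt_iff x hx]
    simpa using hab
  · change rankEquiv y' hy' ((rankEquiv x' hx').symm (rankEquiv x' hx' _)) <
      rankEquiv y' hy' ((rankEquiv x' hx').symm (rankEquiv x' hx' _)) ↔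
      rankEquiv y hy _ < rankEquiv y hy _
    simp only [Equiv.symm_apply_apply, rankEquiv_lt_iff, hgy']

theorem exists_map_of_contains_permOfPoints {P Q α β γ δ : Type} [Fintype P] [Fintype Q]
    [LinearOrder α] [LinearOrder β] [LinearOrder γ] [LinearOrder δ]
    {x : P → α} {y : P → β} {hx : Function.Injective x} {hy : Function.Injective y}
    {x' : Q → γ} {y' : Q → δ} {hx' : Function.Injective x'} {hy' : Function.Injective y'}
    (h : Contains (permOfPoints x' y' hx' hy') (permOfPoints x y hx hy)) :
    ∃ g : P → Q, (∀ p q, x p < x q → x' (g p) < x' (g q)) ∧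
      ∀ p q, y p < y q → y' (g p) < y' (g q) := by
  obtain ⟨f, hf⟩ := h
  refine ⟨fun p => (rankEquiv x' hx').symm (f (rankEquiv x hx p)), fun p q hpq => ?_,
    fun p q hpq => ?_⟩
  · rw [← rankEquiv_lt_iff x' hx']
    simpa [rankEquiv_lt_iff] using hpq
  · have := (hf (rankEquiv x hx p) (rankEquiv x hx q)).2
      (by simpa [permOfPoints, rankEquiv_lt_iff] using hpq)
    simpa [permOfPoints, rankEquiv_lt_iff] using this

theorem exists_points_of_contains_decreasing {P α β : Type} [Fintype P]
    [LinearOrder α] [LinearOrder β] {x : P → α} {y : P → β} {hx : Function.Injective x}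
    {hy : Function.Injective y} {k : ℕ} (h : Contains (permOfPoints x y hx hy) (decreasing k)) :
    ∃ p : Fin k → P, ∀ a b, a < b → x (p a) < x (p b) ∧ y (p b) < y (p a) := by
  obtain ⟨f, hf⟩ := h
  refine ⟨fun a => (rankEquiv x hx).symm (f a), fun a b hab => ⟨?_, ?_⟩⟩
  · rw [← rankEquiv_lt_iff x hx]
    simpa using hab
  · have := (hf b a).2 (by simpa [decreasing] using hab)
    simpa [permOfPoints, rankEquiv_lt_iff] using this

/-! ### Coordinates -/

theorem coord_lt_iff {a b c d a' b' c' d' : ℕ} :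
    coord a b c d < coord a' b' c' d' ↔
      a < a' ∨ a = a' ∧ (b < b' ∨ b = b' ∧ (c < c' ∨ c = c' ∧ d < d')) := by
  simp [coord, Prod.Lex.toLex_lt_toLex]

theorem coord_sandwich {a b c d e a' b' c' d' : ℕ} (h : coord a b c d < coord a' b' c' d')
    (h' : coord a' b' c' d' < coord a b c e) :
    a' = a ∧ b' = b ∧ c' = c ∧ d < d' ∧ d' < e := by
  rw [coord_lt_iff] at h h'
  omega

theorem Step.num_pos {c : ℕ} (m : Step c) : 0 < m.num := by
  cases m <;> simp [Step.num]

theorem Literal.index_div_two {v : ℕ} (s : Literal v) : s.index / 2 = s.1 := by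
  simp only [Literal.index]
  split_ifs <;> omega

theorem Literal.baseIndex_div_two {v : ℕ} (s : Literal v) : s.baseIndex / 2 = s.1 := by
  simp only [Literal.baseIndex]
  split_ifs <;> omega

theorem Literal.fst_le_of_index_le {v : ℕ} {s s' : Literal v} (h : s.index ≤ s'.index) :
    s.1 ≤ s'.1 := by
  have := s.index_div_two
  have := s'.index_div_two
  rw [Fin.le_def]
  omega

/-- The bases of `X^T_i` and `X^F_i` are exchanged horizontally, so two literals ordered in the same
way by both numberings differ in the variable. -/
theorem Literal.fst_lt_or_eq {v : ℕ} {s s' : Literal v} (h : s.index ≤ s'.index)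
    (hb : s.baseIndex ≤ s'.baseIndex) : s.1 < s'.1 ∨ s = s' := by
  obtain ⟨i, a⟩ := s
  obtain ⟨j, b⟩ := s'
  simp only [Literal.index, Literal.baseIndex, Fin.lt_def, Prod.mk.injEq, Fin.ext_iff] at *
  cases a <;> cases b <;> simp at * <;> omega

/-! ### The levels of a fork gadget -/

/-- A staircase has a bend of the given copy in the fork gadget of the clause `K`. -/
def Clause.HasCopy {v : ℕ} (K : Clause v) (s : Literal v) (r : Copy) : Prop :=
  r = .main ∨ K.Bypassed s

theorem Clause.level_bypass_lt {v : ℕ} (K : Clause v) {s : Literal v} (h : K.Bypassed s) :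
    K.level s .bypass < K.level s .main := by
  have h1 := K.i_lt_j
  have h2 := K.j_lt_k
  obtain ⟨x, b⟩ := s
  simp only [Clause.Bypassed, Clause.level, Fin.lt_def, Fin.le_def, Fin.ext_iff] at *
  split_ifs <;> simp_all <;> omega

theorem Clause.level_le_two {v : ℕ} (K : Clause v) (s : Literal v) (r : Copy) :
    K.level s r ≤ 2 := by
  cases r <;> simp only [Clause.level] <;> split_ifs <;> omega

theorem Clause.HasCopy.eq_of_level_eq {v : ℕ} {K : Clause v} {s : Literal v} {r r' : Copy}
    (h : K.HasCopy s r) (h' : K.HasCopy s r') (hl : K.level s r = K.level s r') : r = r' := by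
  cases r <;> cases r' <;> first | rfl | skip
  · exact absurd hl (K.level_ne s (by simpa [HasCopy] using h'))
  · exact absurd hl.symm (K.level_ne s (by simpa [HasCopy] using h))

theorem Clause.of_level_eq_two {v : ℕ} (K : Clause v) {s : Literal v} {r : Copy}
    (h : K.level s r = 2) : (s.1 = K.j ∧ s.2 ≠ K.signJ) ∨ K.j < s.1 := by
  have h1 := K.i_lt_j
  have h2 := K.j_lt_k
  obtain ⟨x, b⟩ := s
  cases r <;> simp only [level] at * <;> grind

theorem Clause.HasCopy.of_level_eq_zero {v : ℕ} {K : Clause v} {s : Literal v} {r : Copy}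
    (hr : K.HasCopy s r) (h : K.level s r = 0) : (s.1 = K.j ∧ s.2 ≠ K.signJ) ∨ s.1 < K.j := by
  have h1 := K.i_lt_j
  have h2 := K.j_lt_k
  obtain ⟨x, b⟩ := s
  cases r <;> simp only [HasCopy, Bypassed, level] at * <;> grind

/-- A top bend never precedes a middle bend that precedes a bottom bend: the first of the top bends
and the last of the bottom ones belong to the same staircase, which has no middle bend. -/
theorem Clause.not_three_levels {v : ℕ} (K : Clause v) {s₀ s₁ s₂ : Literal v} {r₀ r₁ r₂ : Copy}
    (h₀ : K.HasCopy s₀ r₀) (h0 : K.level s₀ r₀ = 0) (h1 : K.level s₁ r₁ = 1)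
    (h2 : K.level s₂ r₂ = 2) (h21 : s₂.index ≤ s₁.index) (h10 : s₁.index ≤ s₀.index) : False := by
  have hv1 := Literal.fst_le_of_index_le h21
  have hv2 := Literal.fst_le_of_index_le h10
  have hij := K.i_lt_j
  have hjk := K.j_lt_k
  obtain ⟨e2, b2⟩ : s₂.1 = K.j ∧ s₂.2 ≠ K.signJ := by
    rcases K.of_level_eq_two h2 with h | h
    · exact h
    · rcases h₀.of_level_eq_zero h0 with h' | h' <;> omega
  obtain ⟨e0, b0⟩ : s₀.1 = K.j ∧ s₀.2 ≠ K.signJ := by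
    rcases h₀.of_level_eq_zero h0 with h' | h'
    · exact h'
    · omega
  have e : s₂ = s₀ := Prod.ext (e2.trans e0.symm) (by
    revert b2 b0; cases s₂.2 <;> cases s₀.2 <;> cases K.signJ <;> simp)
  subst e
  obtain rfl : s₁ = s₂ := Literal.index_injective (le_antisymm h10 h21)
  cases r₁ <;> simp [Clause.level, e2, b2, hij.not_gt, hij.ne'] at h1

/-! ### Avoidance of decreasing sequences -/

/-- The element lies on an outer bend. -/
def PatternElement.IsOuter {v c M : ℕ} (p : PatternElement v c M) : Prop :=
  ∃ e : XElement v c, p = .inl e ∧ e.side = .outer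

/-- The element lies on an outer bend. -/
def TextElement.IsOuter {v c : ℕ} {Φ : Formula v c} (p : TextElement Φ) : Prop :=
  ∃ e : YElement Φ, p = .inl e ∧ e.1.side = .outer

/-- The pattern is the union of two increasing sequences: the outer bends, and the anchor followed
by the inner bends. -/
theorem pattern_increasing {v c M : ℕ} {p q : PatternElement v c M}
    (hx : patternColumn p < patternColumn q) (hy : patternRow q < patternRow p) :
    ¬ (PatternElement.IsOuter p ↔ PatternElement.IsOuter q) := by
  unfold PatternElement.IsOuter
  rcases p with ⟨i, m, sd, k⟩ | a <;> rcases q with ⟨i', m', sd', k'⟩ | a' <;>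
    simp only [patternColumn, patternRow, Sum.elim_inl, Sum.elim_inr, XElement.column,
      XElement.row, anchorColumn, anchorRow, coord_lt_iff] at hx hy
  · cases sd <;> cases sd' <;> simp
    all_goals
      cases m <;> cases m' <;> cases k <;> cases k' <;>
        simp [columnBlock, Step.num, columnSlot, rowSlot] at hx hy <;> omega
  · cases sd <;> simp
    cases m <;> simp [columnBlock, Step.num] at hx
  · cases sd' <;> simp
    cases m' <;> simp [Step.num] at hy
  · omega

theorem pattern_avoids {v c : ℕ} (Φ : Formula v c) : Avoids (pattern Φ) (decreasing 3) := by
  intro h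
  obtain ⟨p, hp⟩ := exists_points_of_contains_decreasing h
  have h1 := hp 0 1 (by decide)
  have h2 := hp 1 2 (by decide)
  have h3 := hp 0 2 (by decide)
  have h1 := pattern_increasing h1.1 h1.2
  have h2 := pattern_increasing h2.1 h2.2
  have h3 := pattern_increasing h3.1 h3.2
  tauto

theorem hasCopy_of_present_fork {v c : ℕ} {Φ : Formula v c} {s : Literal v} {t : Fin c}
    {sd : Side} {r : Copy} {k : Corner} (h : Candidate.Present Φ ⟨s, .fork t, sd, r, k⟩) :
    (Φ t).HasCopy s r := by
  simpa [Candidate.Present, onBypass, Clause.HasCopy] using h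

theorem hasCopy_of_present_merge {v c : ℕ} {Φ : Formula v c} {s : Literal v} {t : Fin c}
    {r : Copy} {k : Corner} (h : Candidate.Present Φ ⟨s, .merge t, .outer, r, k⟩) :
    (Φ t).HasCopy s r := by
  simpa [Candidate.Present, onBypass, Clause.HasCopy] using h

/-- The anchor followed by the inner bends is an increasing sequence of the text. -/
theorem text_increasing {v c : ℕ} {Φ : Formula v c} {p q : TextElement Φ}
    (hx : textColumn Φ p < textColumn Φ q) (hy : textRow Φ q < textRow Φ p) :
    TextElement.IsOuter p ∨ TextElement.IsOuter q := by
  unfold TextElement.IsOuter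
  rcases p with ⟨⟨s, m, sd, r, k⟩, hP⟩ | a <;> rcases q with ⟨⟨s', m', sd', r', k'⟩, hP'⟩ | a' <;>
    simp only [textColumn, textRow, Sum.elim_inl, Sum.elim_inr, Candidate.column,
      Candidate.row, anchorColumn, anchorRow, coord_lt_iff] at hx hy
  · cases sd <;> cases sd' <;> simp
    obtain rfl : m = m' := Step.num_injective (by
      cases m <;> cases m' <;> simp only [columnBlock, Step.num] at * <;> omega)
    cases m <;> cases k <;> cases k' <;>
      simp [columnLevel, columnStair, columnSlot, rowSlot] at hx hy <;> omega
  · cases sd <;> simp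
    cases m <;> simp [columnBlock, Step.num] at hx
  · cases sd' <;> simp
    cases m' <;> simp [Step.num] at hy
  · omega

theorem outer_slots {r : Copy} {k k' : Corner}
    (hx : columnSlot .outer r k < columnSlot .outer r k')
    (hy : rowSlot .outer r k' < rowSlot .outer r k) : False := by
  cases r <;> cases k <;> cases k' <;> simp [columnSlot, rowSlot] at hx hy

/-- Two elements of outer bends in decreasing position belong to the same step. At the base they lie
on the two staircases of a variable; at the two steps of a clause their levels differ, in the
direction opposite to their staircases' order. -/
theorem outer_decrease {v c : ℕ} {Φ : Formula v c} {e e' : Candidate v c}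
    (hP : e.Present Φ) (hP' : e'.Present Φ) (he : e.side = .outer) (he' : e'.side = .outer)
    (hx : e.column Φ < e'.column Φ) (hy : e'.row Φ < e.row Φ) :
    e'.step = e.step ∧
      (e.step = .base → e.lit.1 = e'.lit.1 ∧ e'.lit.index < e.lit.index) ∧
      (∀ t, e.step = .fork t → (Φ t).level e'.lit e'.copy < (Φ t).level e.lit e.copy ∧
        e.lit.index ≤ e'.lit.index) ∧
      (∀ t, e.step = .merge t → (Φ t).level e.lit e.copy < (Φ t).level e'.lit e'.copy ∧
        e'.lit.index ≤ e.lit.index) := by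
  obtain ⟨s, m, sd, r, k⟩ := e
  obtain ⟨s', m', sd', r', k'⟩ := e'
  dsimp only at he he' ⊢
  subst he he'
  simp only [Candidate.column, Candidate.row, coord_lt_iff] at hx hy
  obtain rfl : m = m' := Step.num_injective (by
    cases m <;> cases m' <;> simp only [columnBlock, Step.num] at * <;> omega)
  refine ⟨rfl, ?_, ?_, ?_⟩
  · rintro rfl
    have hr : r = .main := by simpa [Candidate.Present, onBypass] using hP
    have hr' : r' = .main := by simpa [Candidate.Present, onBypass] using hP'
    subst hr hr'
    simp only [columnBlock, columnLevel, columnStair, rowLevel, lt_self_iff_false, false_or,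
      true_and] at hx hy
    have hb := s.baseIndex_div_two
    have hb' := s'.baseIndex_div_two
    have hi := s.index_div_two
    have hi' := s'.index_div_two
    refine ⟨Fin.ext (by omega), ?_⟩
    rcases hy with hy | ⟨hy, hy2⟩
    · exact hy
    · obtain rfl := Literal.index_injective hy
      exact (outer_slots (by omega) hy2).elim
  · rintro t rfl
    have hr := hasCopy_of_present_fork hP
    have hr' := hasCopy_of_present_fork hP'
    simp only [columnBlock, columnLevel, columnStair, rowLevel, lt_self_iff_false, false_or,
      true_and] at hx hy
    refine ⟨?_, by omega⟩
    by_contra hl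
    have hi : s.index = s'.index := by omega
    obtain rfl := Literal.index_injective hi
    obtain rfl := hr.eq_of_level_eq hr' (by omega)
    exact outer_slots (r := r) (k := k) (k' := k') (by omega) (by omega)
  · rintro t rfl
    have hr := hasCopy_of_present_merge hP
    have hr' := hasCopy_of_present_merge hP'
    simp only [columnBlock, columnLevel, columnStair, rowLevel, lt_self_iff_false, false_or,
      true_and] at hx hy
    refine ⟨?_, by omega⟩
    by_contra hl
    have hi : s.index = s'.index := by omega
    obtain rfl := Literal.index_injective hi
    obtain rfl := hr.eq_of_level_eq hr' (by omega)
    exact outer_slots (r := r) (k := k) (k' := k') (by omega) (by omega)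

/-- The outer bends of the text contain no `321`. -/
theorem not_three_outer {v c : ℕ} {Φ : Formula v c} {p₁ p₂ p₃ : TextElement Φ}
    (h₁ : TextElement.IsOuter p₁)
    (h₂ : TextElement.IsOuter p₂)
    (h₃ : TextElement.IsOuter p₃)
    (h12 : textColumn Φ p₁ < textColumn Φ p₂ ∧ textRow Φ p₂ < textRow Φ p₁)
    (h23 : textColumn Φ p₂ < textColumn Φ p₃ ∧ textRow Φ p₃ < textRow Φ p₂) : False := by
  obtain ⟨e₁, rfl, o₁⟩ := h₁
  obtain ⟨e₂, rfl, o₂⟩ := h₂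
  obtain ⟨e₃, rfl, o₃⟩ := h₃
  obtain ⟨m12, b12, f12, g12⟩ := outer_decrease e₁.2 e₂.2 o₁ o₂ h12.1 h12.2
  obtain ⟨m23, b23, f23, g23⟩ := outer_decrease e₂.2 e₃.2 o₂ o₃ h23.1 h23.2
  rw [m12] at b23 f23 g23
  obtain ⟨⟨s₁, m₁, sd₁, r₁, k₁⟩, P₁⟩ := e₁
  obtain ⟨⟨s₂, m₂, sd₂, r₂, k₂⟩, P₂⟩ := e₂
  obtain ⟨⟨s₃, m₃, sd₃, r₃, k₃⟩, P₃⟩ := e₃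
  dsimp only at *
  subst o₁ o₂ o₃ m12 m23
  cases m₃ with
  | base =>
    obtain ⟨hv, hi⟩ := b12 rfl
    obtain ⟨hv', hi'⟩ := b23 rfl
    have := s₁.index_div_two
    have := s₂.index_div_two
    have := s₃.index_div_two
    omega
  | fork t =>
    obtain ⟨hv, hi⟩ := f12 t rfl
    obtain ⟨hv', hi'⟩ := f23 t rfl
    have := (Φ t).level_le_two s₁ r₁
    exact (Φ t).not_three_levels (hasCopy_of_present_fork P₃)
      (by omega) (by omega : (Φ t).level s₂ r₂ = 1) (by omega : (Φ t).level s₁ r₁ = 2) hi hi'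
  | merge t =>
    obtain ⟨hv, hi⟩ := g12 t rfl
    obtain ⟨hv', hi'⟩ := g23 t rfl
    have := (Φ t).level_le_two s₃ r₃
    exact (Φ t).not_three_levels (hasCopy_of_present_merge P₁)
      (by omega) (by omega : (Φ t).level s₂ r₂ = 1) (by omega : (Φ t).level s₃ r₃ = 2) hi' hi

theorem text_avoids {v c : ℕ} (Φ : Formula v c) : Avoids (text Φ) (decreasing 4) := by
  intro h
  obtain ⟨p, hp⟩ := exists_points_of_contains_decreasing h
  have h01 := hp 0 1 (by decide)
  have h02 := hp 0 2 (by decide)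
  have h03 := hp 0 3 (by decide)
  have h12 := hp 1 2 (by decide)
  have h13 := hp 1 3 (by decide)
  have h23 := hp 2 3 (by decide)
  have o01 := text_increasing h01.1 h01.2
  have o02 := text_increasing h02.1 h02.2
  have o03 := text_increasing h03.1 h03.2
  have o12 := text_increasing h12.1 h12.2
  have o13 := text_increasing h13.1 h13.2
  have o23 := text_increasing h23.1 h23.2
  -- Three of the four elements lie on outer bends and form a `321`.
  have n012 := fun a b c => not_three_outer (p₁ := p 0) (p₂ := p 1) (p₃ := p 2) a b c h01 h12
  have n013 := fun a b c => not_three_outer (p₁ := p 0) (p₂ := p 1) (p₃ := p 3) a b c h01 h13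
  have n023 := fun a b c => not_three_outer (p₁ := p 0) (p₂ := p 2) (p₃ := p 3) a b c h02 h23
  have n123 := fun a b c => not_three_outer (p₁ := p 1) (p₂ := p 2) (p₃ := p 3) a b c h12 h23
  grind only

/-! ### From satisfying assignments to occurrences -/

/-- If the clause holds, the staircases chosen by the assignment can be led through the fork gadget
at nondecreasing levels. -/
theorem Clause.Holds.exists_copy {v : ℕ} {K : Clause v} {φ : Fin v → Bool} (h : K.Holds φ) :
    ∃ r : Fin v → Copy, (∀ i, K.HasCopy (i, φ i) (r i)) ∧
      ∀ i j, i ≤ j → K.level (i, φ i) (r i) ≤ K.level (j, φ j) (r j) := by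
  have h1 := K.i_lt_j
  have h2 := K.j_lt_k
  rcases h with h | h | h
  · -- `X_i^+` is at level `0`, so every bypass is available.
    refine ⟨fun a => if K.Bypassed (a, φ a) then .bypass else .main, fun a => ?_, fun a b hab => ?_⟩
    · simp only [HasCopy]
      split_ifs <;> simp_all
    · by_cases ha : K.Bypassed (a, φ a) <;> by_cases hb : K.Bypassed (b, φ b) <;>
        simp only [ha, hb, if_true, if_false, level] <;> simp only [Bypassed] at ha hb <;>
        grind (splits := 20)
  · -- `X_j^+` is at level `1`; bypasses keep the staircases between `X_j` and `X_k` there.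
    refine ⟨fun a => if K.j < a ∧ a < K.k then .bypass else .main, fun a => ?_, fun a b hab => ?_⟩
    · simp only [HasCopy, Bypassed]
      split_ifs <;> simp_all
    · by_cases ha : K.j < a ∧ a < K.k <;> by_cases hb : K.j < b ∧ b < K.k <;>
        simp only [ha, hb, and_self, if_true, if_false, level] <;> grind (splits := 20)
  · -- `X_k^+` is at level `2`, so no bypass is needed.
    refine ⟨fun _ => .main, fun a => .inl rfl, fun a b hab => ?_⟩
    simp only [level]
    grind (splits := 20)

/-- Nondecreasing levels force the clause to hold: if all three literals fail, then `X_i^-` and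
`X_k^-` are at level `1`, while `X_j^-` or its bypass between them is at level `2` or `0`. -/
theorem Clause.holds_of_monotone {v : ℕ} {K : Clause v} {φ : Fin v → Bool} {r : Fin v → Copy}
    (hr : ∀ i, K.HasCopy (i, φ i) (r i)) (hm : ∀ i j, i < j → K.level (i, φ i) (r i) ≤
      K.level (j, φ j) (r j)) : K.Holds φ := by
  by_contra h
  have h1 := K.i_lt_j
  have h2 := K.j_lt_k
  simp only [Clause.Holds, not_or] at h
  obtain ⟨hi, hj, hk⟩ := h
  have hij := hm _ _ h1
  have hjk := hm _ _ h2
  have ri : r K.i = .main := by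
    have := hr K.i
    simpa [HasCopy, Bypassed, h1.not_gt, h1.ne, (h1.trans h2).not_gt] using this
  have rk : r K.k = .main := by
    have := hr K.k
    simpa [HasCopy, Bypassed, h2.not_gt, h2.ne', (h1.trans h2).not_gt] using this
  rw [ri] at hij
  rw [rk] at hjk
  cases hc : r K.j <;> rw [hc] at hij hjk <;>
    simp [level, hi, hj, hk, h1.not_gt, h1.ne', h2.not_gt, h2.ne', (h1.trans h2).not_gt,
      (h1.trans h2).ne'] at hij hjk

/-- The copy of a bend that an occurrence with the choices `r` at the clauses runs through. -/
def chosenCopy {v c : ℕ} (r : Fin c → Fin v → Copy) (i : Fin v) (m : Step c) (sd : Side) : Copy :=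
  match onBypass m sd with
  | some t => r t i
  | none => .main

theorem rowLevel_chosenCopy_mono {v c : ℕ} {Φ : Formula v c} {φ : Fin v → Bool}
    {r : Fin c → Fin v → Copy}
    (hm : ∀ t i j, i ≤ j → (Φ t).level (i, φ i) (r t i) ≤ (Φ t).level (j, φ j) (r t j))
    (m : Step c) (sd sd' : Side) {i j : Fin v} (h : i ≤ j) :
    rowLevel Φ (i, φ i) (chosenCopy r i m sd) m ≤ rowLevel Φ (j, φ j) (chosenCopy r j m sd') m := by
  cases m <;> simp only [rowLevel, le_refl, chosenCopy, onBypass]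
  exact hm _ _ _ h

theorem columnLevel_chosenCopy_mono {v c : ℕ} {Φ : Formula v c} {φ : Fin v → Bool}
    {r : Fin c → Fin v → Copy}
    (hm : ∀ t i j, i ≤ j → (Φ t).level (i, φ i) (r t i) ≤ (Φ t).level (j, φ j) (r t j))
    {m m' : Step c} {sd sd' : Side} (hb : columnBlock m sd = columnBlock m' sd') {i j : Fin v}
    (h : i ≤ j) :
    columnLevel Φ (i, φ i) (chosenCopy r i m sd) m sd ≤
      columnLevel Φ (j, φ j) (chosenCopy r j m' sd') m' sd' := by
  cases m <;> cases sd <;> cases m' <;> cases sd' <;>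
    simp only [columnBlock, Step.num] at hb <;>
    simp only [columnLevel, rowLevel, chosenCopy, onBypass, le_refl, zero_le] <;>
    first
    | omega
    | (rename_i t t'
       obtain rfl : t = t' := Fin.ext (by omega)
       exact hm _ _ _ h)

theorem index_lt_of_lt {v : ℕ} {i j : Fin v} (h : i < j) (a b : Bool) :
    Literal.index (i, a) < Literal.index (j, b) := by
  have := Literal.index_div_two (i, a)
  have := Literal.index_div_two (j, b)
  simp only [Fin.lt_def] at *
  omega

theorem baseIndex_lt_of_lt {v : ℕ} {i j : Fin v} (h : i < j) (a b : Bool) :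
    Literal.baseIndex (i, a) < Literal.baseIndex (j, b) := by
  have := Literal.baseIndex_div_two (i, a)
  have := Literal.baseIndex_div_two (j, b)
  simp only [Fin.lt_def] at *
  omega

theorem columnStair_eq {v c : ℕ} (s : Literal v) {m m' : Step c} {sd sd' : Side}
    (hb : columnBlock m sd = columnBlock m' sd') : columnStair s m sd = columnStair s m' sd' := by
  cases m <;> cases sd <;> cases m' <;> cases sd' <;>
    simp only [columnBlock, Step.num] at hb <;> first | rfl | omega

theorem columnStair_lt_of_lt {v c : ℕ} {i j : Fin v} (h : i < j) (a b : Bool) (m : Step c)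
    (sd : Side) : columnStair (i, a) m sd < columnStair (j, b) m sd := by
  cases m <;> cases sd <;>
    first
    | exact index_lt_of_lt h a b
    | exact baseIndex_lt_of_lt h a b

theorem rowSlot_chosenCopy {v c : ℕ} (r : Fin c → Fin v → Copy) (i : Fin v) (m : Step c)
    {sd sd' : Side} {k k' : Corner} (h : rowSlot sd .main k < rowSlot sd' .main k') :
    rowSlot sd (chosenCopy r i m sd) k < rowSlot sd' (chosenCopy r i m sd') k' := by
  cases m with
  | base => cases sd <;> cases sd' <;> exact h
  | fork t =>
    simp only [chosenCopy, onBypass]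
    cases r t i <;> cases sd <;> cases sd' <;> cases k <;> cases k' <;> simp_all [rowSlot]
  | merge t =>
    cases hr : r t i <;> cases sd <;> cases sd' <;> cases k <;> cases k' <;>
      simp_all [rowSlot, chosenCopy, onBypass]

theorem columnSlot_chosenCopy {v c : ℕ} (r : Fin c → Fin v → Copy) (i : Fin v) {m m' : Step c}
    {sd sd' : Side} (hb : columnBlock m sd = columnBlock m' sd') {k k' : Corner}
    (h : columnSlot sd .main k < columnSlot sd' .main k') :
    columnSlot sd (chosenCopy r i m sd) k < columnSlot sd' (chosenCopy r i m' sd') k' := by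
  cases sd <;> cases sd'
  · obtain rfl : m = m' := Step.num_injective (by
      cases m <;> cases m' <;> simp only [columnBlock, Step.num] at * <;> omega)
    cases chosenCopy r i m .outer <;> cases k <;> cases k' <;> simp_all [columnSlot]
  · cases chosenCopy r i m .outer <;> cases k <;> cases k' <;> simp_all [columnSlot]
  · cases chosenCopy r i m' .outer <;> cases k <;> cases k' <;> simp_all [columnSlot]
  · cases chosenCopy r i m .inner <;> cases chosenCopy r i m' .inner <;>
      cases k <;> cases k' <;> exact h

theorem present_chosenCopy {v c : ℕ} {Φ : Formula v c} {φ : Fin v → Bool}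
    {r : Fin c → Fin v → Copy} (hr : ∀ t i, (Φ t).HasCopy (i, φ i) (r t i)) (e : XElement v c) :
    Candidate.Present Φ
      ⟨(e.var, φ e.var), e.step, e.side, chosenCopy r e.var e.step e.side, e.corner⟩ := by
  simp only [Candidate.Present, chosenCopy]
  cases onBypass e.step e.side with
  | none => exact .inl rfl
  | some t => simpa [Clause.HasCopy] using hr t e.var

/-- The occurrence of the pattern given by an assignment `φ` and choices `r` of the copies. -/
def occurrence {v c : ℕ} {Φ : Formula v c} {φ : Fin v → Bool} {r : Fin c → Fin v → Copy}
    (hr : ∀ t i, (Φ t).HasCopy (i, φ i) (r t i)) :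
    PatternElement v c (anchorLength Φ) → TextElement Φ
  | .inl e => .inl ⟨_, present_chosenCopy hr e⟩
  | .inr a => .inr a

theorem occurrence_column_lt {v c : ℕ} {Φ : Formula v c} {φ : Fin v → Bool}
    {r : Fin c → Fin v → Copy} (hr : ∀ t i, (Φ t).HasCopy (i, φ i) (r t i))
    (hm : ∀ t i j, i ≤ j → (Φ t).level (i, φ i) (r t i) ≤ (Φ t).level (j, φ j) (r t j))
    (p q : PatternElement v c (anchorLength Φ)) (h : patternColumn p < patternColumn q) :
    textColumn Φ (occurrence hr p) < textColumn Φ (occurrence hr q) := by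
  rcases p with ⟨i, m, sd, k⟩ | a <;> rcases q with ⟨i', m', sd', k'⟩ | a' <;>
    simp only [patternColumn, Sum.elim_inl, Sum.elim_inr, XElement.column, anchorColumn,
      textColumn, occurrence, Candidate.column, coord_lt_iff] at h ⊢
  · rcases h with h | ⟨hb, h | ⟨-, h | ⟨hi, h⟩⟩⟩
    · exact .inl h
    · omega
    · have hl := columnLevel_chosenCopy_mono hm hb (Fin.le_def.2 h.le)
      have hs := columnStair_lt_of_lt h (φ i) (φ i') m sd
      rw [columnStair_eq (i', φ i') hb] at hs
      omega
    · obtain rfl := Fin.ext hi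
      have hl := (columnLevel_chosenCopy_mono hm hb le_rfl).antisymm
        (columnLevel_chosenCopy_mono hm hb.symm (le_refl i))
      exact .inr ⟨hb, .inr ⟨hl, .inr ⟨columnStair_eq _ hb, columnSlot_chosenCopy r i hb h⟩⟩⟩
  · have : columnBlock m sd < 1 := by
      cases sd <;> cases m <;> simp only [columnBlock, Step.num] at h ⊢ <;> omega
    exact .inl this
  · have : 1 < columnBlock m' sd' := by
      cases sd' <;> cases m' <;> simp only [columnBlock, Step.num] at h ⊢ <;> omega
    exact .inl this
  · exact h

theorem occurrence_row_lt {v c : ℕ} {Φ : Formula v c} {φ : Fin v → Bool}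
    {r : Fin c → Fin v → Copy} (hr : ∀ t i, (Φ t).HasCopy (i, φ i) (r t i))
    (hm : ∀ t i j, i ≤ j → (Φ t).level (i, φ i) (r t i) ≤ (Φ t).level (j, φ j) (r t j))
    (p q : PatternElement v c (anchorLength Φ)) (h : patternRow p < patternRow q) :
    textRow Φ (occurrence hr p) < textRow Φ (occurrence hr q) := by
  rcases p with ⟨i, m, sd, k⟩ | a <;> rcases q with ⟨i', m', sd', k'⟩ | a' <;>
    simp only [patternRow, Sum.elim_inl, Sum.elim_inr, XElement.row, anchorRow,
      textRow, occurrence, Candidate.row, coord_lt_iff] at h ⊢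
  · rcases h with h | ⟨hb, h | ⟨-, h | ⟨hi, h⟩⟩⟩
    · exact .inl h
    · omega
    · obtain rfl := Step.num_injective hb
      have hl := rowLevel_chosenCopy_mono hm m sd sd' (Fin.le_def.2 h.le)
      have hs := index_lt_of_lt h (φ i) (φ i')
      omega
    · obtain rfl := Step.num_injective hb
      obtain rfl := Fin.ext hi
      have hl := (rowLevel_chosenCopy_mono hm m sd sd' (le_refl i)).antisymm
        (rowLevel_chosenCopy_mono hm m sd' sd (le_refl i))
      exact .inr ⟨rfl, .inr ⟨hl, .inr ⟨rfl, rowSlot_chosenCopy r i m h⟩⟩⟩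
  · have := m.num_pos
    omega
  · exact .inl m'.num_pos
  · exact h

theorem contains_of_satisfiable {v c : ℕ} {Φ : Formula v c} (h : Satisfiable Φ) :
    Contains (text Φ) (pattern Φ) := by
  obtain ⟨φ, hφ⟩ := h
  choose r hr hm using fun t => (hφ t).exists_copy
  exact contains_permOfPoints_of_lt _ _ _ _ (occurrence hr) (occurrence_column_lt hr hm)
    (occurrence_row_lt hr hm)

/-! ### From occurrences to satisfying assignments -/

/-- The element of the text is the given element of a staircase or of a bypass. -/
def TextElement.Is {v c : ℕ} {Φ : Formula v c} (x : TextElement Φ) (e : Candidate v c) : Prop :=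
  ∃ h : e.Present Φ, x = .inl ⟨e, h⟩

theorem TextElement.Is.column {v c : ℕ} {Φ : Formula v c} {x : TextElement Φ} {e : Candidate v c}
    (h : TextElement.Is x e) : textColumn Φ x = e.column Φ := by
  obtain ⟨h, rfl⟩ := h
  rfl

theorem TextElement.Is.row {v c : ℕ} {Φ : Formula v c} {x : TextElement Φ} {e : Candidate v c}
    (h : TextElement.Is x e) : textRow Φ x = e.row Φ := by
  obtain ⟨h, rfl⟩ := h
  rfl

/-- The copy of the inner bend that is sandwiched from the left by the given copy of the outer bend
of the same step. At a merge the bypass has ended. -/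
def Step.innerCopy {c : ℕ} : Step c → Copy → Copy
  | .fork _, r => r
  | _, _ => .main

/-- All that an outer bend sandwiches from the left is the corresponding inner bend. -/
theorem inner_of_row_sandwich {v c : ℕ} {Φ : Formula v c} {s : Literal v} {m : Step c} {r : Copy}
    (hP : Candidate.Present Φ ⟨s, m, .outer, r, .lo⟩) {x : TextElement Φ}
    (hlo : Candidate.row Φ ⟨s, m, .outer, r, .lo⟩ < textRow Φ x)
    (hhi : textRow Φ x < Candidate.row Φ ⟨s, m, .outer, r, .hi⟩)
    (hc : Candidate.column Φ ⟨s, m, .outer, r, .hi⟩ < textColumn Φ x) :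
    ∃ k, TextElement.Is x ⟨s, m, .inner, m.innerCopy r, k⟩ := by
  rcases x with ⟨⟨s', m', sd, r', k⟩, hP'⟩ | a
  · simp only [textRow, textColumn, Sum.elim_inl] at hlo hhi hc
    obtain ⟨h1, h2, h3, h4, h5⟩ := coord_sandwich hlo hhi
    obtain rfl := Step.num_injective h1
    obtain rfl := Literal.index_injective h3
    cases sd with
    | inner =>
      suffices r' = m'.innerCopy r by subst this; exact ⟨k, hP', rfl⟩
      cases m' with
      | base => simpa [Candidate.Present, onBypass, Step.innerCopy] using hP'
      | fork t =>
        exact (hasCopy_of_present_fork hP').eq_of_level_eq (hasCopy_of_present_fork hP) h2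
      | merge t => simpa [Candidate.Present, onBypass, Step.innerCopy] using hP'
    | outer =>
      exfalso
      have hr : r = .main ∧ r' = .bypass := by
        cases r <;> cases r' <;> cases k <;> simp [rowSlot] at h4 h5 ⊢
      obtain ⟨rfl, rfl⟩ := hr
      cases m' with
      | base => simp [Candidate.Present, onBypass] at hP'
      | fork t =>
        have := (hasCopy_of_present_fork hP').eq_of_level_eq (hasCopy_of_present_fork hP) h2
        simp at this
      | merge t =>
        -- The outer bend is to the right of that of the bypass.
        have hB : (Φ t).Bypassed s' := by
          simpa [Clause.HasCopy] using hasCopy_of_present_merge hP'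
        have := (Φ t).level_bypass_lt hB
        simp only [Candidate.column, columnLevel, coord_lt_iff] at hc
        omega
  · have := m.num_pos
    simp only [textRow, Sum.elim_inr, anchorRow, Candidate.row, coord_lt_iff] at hlo
    omega

/-- All that an inner bend sandwiches from below are outer bends of its staircase at the next step:
one at the end of a bypass, and two at its beginning. -/
theorem outer_of_column_sandwich {v c : ℕ} {Φ : Formula v c} {s : Literal v} {m m' : Step c}
    (hm : m'.num = m.num + 1) {r : Copy} (hP : Candidate.Present Φ ⟨s, m, .inner, r, .lo⟩)
    {x : TextElement Φ} (hlo : Candidate.column Φ ⟨s, m, .inner, r, .lo⟩ < textColumn Φ x)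
    (hhi : textColumn Φ x < Candidate.column Φ ⟨s, m, .inner, r, .hi⟩) :
    ∃ r' k, TextElement.Is x ⟨s, m', .outer, r', k⟩ ∧ ∀ t, m' = .merge t → r' = r := by
  rcases x with ⟨⟨s', m'', sd, r', k⟩, hP'⟩ | a
  · simp only [textColumn, Sum.elim_inl] at hlo hhi
    obtain ⟨h1, h2, h3, h4, h5⟩ := coord_sandwich hlo hhi
    dsimp only at h1 h2 h3 h4 h5
    have hi : columnStair s m .inner = s.index := by cases m <;> rfl
    have hb : columnBlock m .inner = m.num + 1 := by cases m <;> rfl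
    cases sd with
    | inner => cases k <;> simp [columnSlot] at h4 h5
    | outer =>
      obtain rfl : m'' = m' := Step.num_injective (by
        have := m.num_pos
        cases m'' <;> simp only [columnBlock, Step.num] at * <;> omega)
      obtain rfl : s' = s := Literal.index_injective (by
        have := m.num_pos
        cases m'' <;> simp only [columnStair, Step.num] at * <;> omega)
      refine ⟨r', k, ⟨hP', rfl⟩, ?_⟩
      rintro t rfl
      obtain rfl : m = .fork t := Step.num_injective (by simp only [Step.num] at *; omega)
      exact (hasCopy_of_present_merge hP').eq_of_level_eq (hasCopy_of_present_fork hP) h2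
  · have := m.num_pos
    have hb : columnBlock m .inner = m.num + 1 := by cases m <;> rfl
    simp only [textColumn, Sum.elim_inr, anchorColumn, Candidate.column, coord_lt_iff] at hlo
    omega

/-- Only elements of the base are above and to the left of an element of the anchor. -/
theorem base_of_lt_anchor {v c : ℕ} {Φ : Formula v c} {x : TextElement Φ}
    {b : Fin (anchorLength Φ)} (hc : textColumn Φ x < anchorColumn b)
    (hr : anchorRow b < textRow Φ x) : ∃ s k, TextElement.Is x ⟨s, .base, .outer, .main, k⟩ := by
  rcases x with ⟨⟨s, m, sd, r, k⟩, hP⟩ | a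
  · simp only [textColumn, Sum.elim_inl, Candidate.column, anchorColumn, coord_lt_iff] at hc
    obtain ⟨rfl, rfl⟩ : m = .base ∧ sd = .outer := by
      cases m <;> cases sd <;> simp [columnBlock, Step.num] at hc ⊢
    obtain rfl : r = .main := by simpa [Candidate.Present, onBypass] using hP
    exact ⟨s, k, hP, rfl⟩
  · simp only [textColumn, textRow, Sum.elim_inr, anchorColumn, anchorRow, coord_lt_iff] at hc hr
    omega

theorem base_increase {v c : ℕ} {Φ : Formula v c} {x y : TextElement Φ} {s s' : Literal v}
    {k k' : Corner} (hx : TextElement.Is x ⟨s, .base, .outer, .main, k⟩)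
    (hy : TextElement.Is y ⟨s', .base, .outer, .main, k'⟩)
    (hc : textColumn Φ x < textColumn Φ y) (hr : textRow Φ x < textRow Φ y) :
    s.1 < s'.1 ∨ (s = s' ∧ k = .lo ∧ k' = .hi) := by
  rw [hx.column, hy.column] at hc
  rw [hx.row, hy.row] at hr
  simp only [Candidate.column, Candidate.row, coord_lt_iff, columnBlock, columnLevel, columnStair,
    rowLevel] at hc hr
  rcases Literal.fst_lt_or_eq (s := s) (s' := s') (by omega) (by omega) with h | rfl
  · exact .inl h
  · refine .inr ⟨rfl, ?_⟩
    cases k <;> cases k' <;> simp [columnSlot] at hc ⊢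

/-- The first outer bend of a bypass is below and to the right of the bend it replaces, so an
increase among their four elements is one of the two bends. At the end of a bypass an increase could
mix the two copies, which the hypothesis `hm` excludes. -/
theorem outer_increase {v c : ℕ} {Φ : Formula v c} {x y : TextElement Φ} {s : Literal v}
    {m : Step c} {r r' : Copy} {k k' : Corner} (hx : TextElement.Is x ⟨s, m, .outer, r, k⟩)
    (hy : TextElement.Is y ⟨s, m, .outer, r', k'⟩) (hm : ∀ t, m = .merge t → r = r')
    (hc : textColumn Φ x < textColumn Φ y) (hr : textRow Φ x < textRow Φ y) :
    r = r' ∧ k = .lo ∧ k' = .hi := by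
  have hP := hx.1
  have hP' := hy.1
  rw [hx.column, hy.column] at hc
  rw [hx.row, hy.row] at hr
  simp only [Candidate.column, Candidate.row, coord_lt_iff] at hc hr
  obtain rfl : r = r' := by
    cases m with
    | base =>
      have h : r = .main := by simpa [Candidate.Present, onBypass] using hP
      have h' : r' = .main := by simpa [Candidate.Present, onBypass] using hP'
      rw [h, h']
    | fork t =>
      cases r <;> cases r' <;> try rfl
      · have hB : (Φ t).Bypassed s := by
          simpa [Clause.HasCopy] using hasCopy_of_present_fork hP'
        have := (Φ t).level_bypass_lt hB
        simp only [rowLevel] at hr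
        omega
      · cases k <;> cases k' <;> simp [columnSlot, columnLevel] at hc
    | merge t => exact hm t rfl
  refine ⟨rfl, ?_⟩
  cases k <;> cases k' <;> cases r <;> simp [columnSlot] at hc ⊢

theorem inner_increase {v c : ℕ} {Φ : Formula v c} {x y : TextElement Φ} {s : Literal v}
    {m : Step c} {r : Copy} {k k' : Corner} (hx : TextElement.Is x ⟨s, m, .inner, r, k⟩)
    (hy : TextElement.Is y ⟨s, m, .inner, r, k'⟩)
    (hc : textColumn Φ x < textColumn Φ y) : k = .lo ∧ k' = .hi := by
  rw [hx.column, hy.column] at hc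
  simp only [Candidate.column, coord_lt_iff] at hc
  cases k <;> cases k' <;> simp [columnSlot] at hc ⊢

/-- As the anchor is longer than the rest of the text, an injection of the pattern cannot map all of
it outside the anchor of the text. -/
theorem exists_anchor {v c : ℕ} {Φ : Formula v c}
    {g : PatternElement v c (anchorLength Φ) → TextElement Φ} (hg : Function.Injective g) :
    ∃ a b, g (.inr a) = .inr b := by
  by_contra! h
  have hl : ∀ a, ∃ e, g (.inr a) = .inl e := fun a => by
    cases hga : g (.inr a) with
    | inl e => exact ⟨e, rfl⟩
    | inr b => exact absurd hga (h a b)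
  choose e he using hl
  have hi : Function.Injective e := fun a b hab =>
    Sum.inr_injective (hg (by rw [he, he, hab]))
  have := Fintype.card_le_of_injective e hi
  rw [Fintype.card_fin, anchorLength] at this
  omega

/-- The base of the pattern is mapped to the base of the text, and there to one of the bases of
`X^T_i` and `X^F_i` for each `i`: a longest increasing sequence of a `3412` has two elements, and
they form the base of one of the staircases. -/
theorem exists_assignment {v c : ℕ} {Φ : Formula v c}
    {g : PatternElement v c (anchorLength Φ) → TextElement Φ}
    (hgx : ∀ p q, patternColumn p < patternColumn q → textColumn Φ (g p) < textColumn Φ (g q))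
    (hgy : ∀ p q, patternRow p < patternRow q → textRow Φ (g p) < textRow Φ (g q)) :
    ∃ φ : Fin v → Bool, ∀ i k,
      TextElement.Is (g (.inl ⟨i, .base, .outer, k⟩)) ⟨(i, φ i), .base, .outer, .main, k⟩ := by
  have hinj : Function.Injective g := fun p q hpq => by
    by_contra hne
    rcases lt_or_gt_of_ne (patternColumn_injective.ne hne) with h | h
    · exact (hgx _ _ h).ne (by rw [hpq])
    · exact (hgx _ _ h).ne (by rw [hpq])
  obtain ⟨a, b, hab⟩ := exists_anchor hinj
  have hbase : ∀ i k, ∃ s k', TextElement.Is (g (.inl ⟨i, .base, .outer, k⟩))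
      ⟨s, .base, .outer, .main, k'⟩ := by
    intro i k
    have hc := hgx (.inl ⟨i, .base, .outer, k⟩) (.inr a) (by
      simp [patternColumn, XElement.column, anchorColumn, coord_lt_iff, columnBlock])
    have hr := hgy (.inr a) (.inl ⟨i, .base, .outer, k⟩) (by
      simp [patternRow, XElement.row, anchorRow, coord_lt_iff, Step.num])
    rw [hab] at hc hr
    exact base_of_lt_anchor hc hr
  choose s k' hs using hbase
  have hinc : ∀ i j k l, i < j ∨ (i = j ∧ k = .lo ∧ l = .hi) →
      (s i k).1 < (s j l).1 ∨ (s i k = s j l ∧ k' i k = .lo ∧ k' j l = .hi) := by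
    intro i j k l h
    refine base_increase (hs i k) (hs j l) (hgx _ _ ?_) (hgy _ _ ?_)
    · rcases h with h | ⟨rfl, rfl, rfl⟩
      · simp [patternColumn, XElement.column, coord_lt_iff, h]
      · simp [patternColumn, XElement.column, coord_lt_iff, columnSlot]
    · rcases h with h | ⟨rfl, rfl, rfl⟩
      · simp [patternRow, XElement.row, coord_lt_iff, h]
      · simp [patternRow, XElement.row, coord_lt_iff, rowSlot]
  have hlo : StrictMono fun i => (s i .lo).1 := by
    intro i j hij
    have h1 := hinc i i .lo .hi (.inr ⟨rfl, rfl, rfl⟩)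
    have h2 := hinc i j .hi .lo (.inl hij)
    rcases h1 with h1 | ⟨h1, -, h1'⟩ <;> rcases h2 with h2 | ⟨h2, h2', -⟩
    · exact h1.trans h2
    · exact h1.trans_eq (congrArg Prod.fst h2)
    · exact (congrArg Prod.fst h1).trans_lt h2
    · simp [h1'] at h2'
  have hhi : StrictMono fun i => (s i .hi).1 := by
    intro i j hij
    have h1 := hinc i j .hi .lo (.inl hij)
    have h2 := hinc j j .lo .hi (.inr ⟨rfl, rfl, rfl⟩)
    rcases h1 with h1 | ⟨h1, -, h1'⟩ <;> rcases h2 with h2 | ⟨h2, h2', -⟩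
    · exact h1.trans h2
    · exact h1.trans_eq (congrArg Prod.fst h2)
    · exact (congrArg Prod.fst h1).trans_lt h2
    · simp [h1'] at h2'
  refine ⟨fun i => (s i .lo).2, fun i k => ?_⟩
  have e1 : (s i .lo).1 = i := hlo.apply_le.antisymm hlo.le_apply
  have e2 : (s i .hi).1 = i := hhi.apply_le.antisymm hhi.le_apply
  obtain ⟨h, hl, hh⟩ := (hinc i i .lo .hi (.inr ⟨rfl, rfl, rfl⟩)).resolve_left
    (by rw [e1, e2]; exact lt_irrefl _)
  have es : s i k = (i, (s i .lo).2) := by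
    cases k
    · exact Prod.ext e1 rfl
    · exact Prod.ext e2 (by rw [h])
  have ek : k' i k = k := by cases k <;> assumption
  have := hs i k
  rwa [es, ek] at this

/-- If the image of an outer bend of the pattern is an outer bend of a staircase or bypass, then the
image of the next inner bend is the next inner bend there. -/
theorem inner_of_outer {v c : ℕ} {Φ : Formula v c}
    {g : PatternElement v c (anchorLength Φ) → TextElement Φ}
    (hgx : ∀ p q, patternColumn p < patternColumn q → textColumn Φ (g p) < textColumn Φ (g q))
    (hgy : ∀ p q, patternRow p < patternRow q → textRow Φ (g p) < textRow Φ (g q))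
    {i : Fin v} {s : Literal v} {m : Step c} {r : Copy}
    (h : ∀ k, TextElement.Is (g (.inl ⟨i, m, .outer, k⟩)) ⟨s, m, .outer, r, k⟩) (k : Corner) :
    TextElement.Is (g (.inl ⟨i, m, .inner, k⟩)) ⟨s, m, .inner, m.innerCopy r, k⟩ := by
  have hk : ∀ k, ∃ k', TextElement.Is (g (.inl ⟨i, m, .inner, k⟩))
      ⟨s, m, .inner, m.innerCopy r, k'⟩ := by
    intro k
    refine inner_of_row_sandwich (h .lo).1 ?_ ?_ ?_
    · rw [← (h .lo).row]
      apply hgy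
      cases k <;> simp [patternRow, XElement.row, coord_lt_iff, rowSlot]
    · rw [← (h .hi).row]
      apply hgy
      cases k <;> simp [patternRow, XElement.row, coord_lt_iff, rowSlot]
    · rw [← (h .hi).column]
      apply hgx
      simp only [patternColumn, Sum.elim_inl, XElement.column, coord_lt_iff]
      left
      cases m <;> simp [columnBlock, Step.num]
  choose k' hk' using hk
  obtain ⟨h1, h2⟩ := inner_increase (hk' .lo) (hk' .hi) (hgx _ _ (by
    simp [patternColumn, XElement.column, coord_lt_iff, columnSlot]))
  have ek : k' k = k := by cases k <;> assumption
  have := hk' k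
  rwa [ek] at this

/-- If the image of an inner bend of the pattern is an inner bend of a staircase or bypass, then the
image of the next outer bend is a next outer bend there. -/
theorem outer_of_inner {v c : ℕ} {Φ : Formula v c}
    {g : PatternElement v c (anchorLength Φ) → TextElement Φ}
    (hgx : ∀ p q, patternColumn p < patternColumn q → textColumn Φ (g p) < textColumn Φ (g q))
    (hgy : ∀ p q, patternRow p < patternRow q → textRow Φ (g p) < textRow Φ (g q))
    {i : Fin v} {s : Literal v} {m m' : Step c} (hm : m'.num = m.num + 1) {r : Copy}
    (h : ∀ k, TextElement.Is (g (.inl ⟨i, m, .inner, k⟩)) ⟨s, m, .inner, r, k⟩) :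
    ∃ r', ∀ k, TextElement.Is (g (.inl ⟨i, m', .outer, k⟩)) ⟨s, m', .outer, r', k⟩ := by
  have hi : columnBlock m .inner = m.num + 1 := by cases m <;> rfl
  have ho : columnBlock m' .outer = m'.num := by
    have := m.num_pos
    cases m'
    · change 1 = _ at hm
      omega
    · rfl
    · rfl
  have hk : ∀ k, ∃ r' k', TextElement.Is (g (.inl ⟨i, m', .outer, k⟩))
      ⟨s, m', .outer, r', k'⟩ ∧ ∀ t, m' = .merge t → r' = r := by
    intro k
    refine outer_of_column_sandwich hm (h .lo).1 ?_ ?_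
    · rw [← (h .lo).column]
      apply hgx
      cases k <;> simp [patternColumn, XElement.column, coord_lt_iff, columnSlot, hi, ho, hm]
    · rw [← (h .hi).column]
      apply hgx
      cases k <;> simp [patternColumn, XElement.column, coord_lt_iff, columnSlot, hi, ho, hm]
  choose r' k' hk' hr' using hk
  obtain ⟨h1, h2, h3⟩ := outer_increase (hk' .lo) (hk' .hi)
    (fun t ht => (hr' .lo t ht).trans (hr' .hi t ht).symm)
    (hgx _ _ (by simp [patternColumn, XElement.column, coord_lt_iff, columnSlot]))
    (hgy _ _ (by simp [patternRow, XElement.row, coord_lt_iff, rowSlot]))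
  refine ⟨r' .lo, fun k => ?_⟩
  have ek : k' k = k := by cases k <;> assumption
  have er : r' k = r' .lo := by
    cases k
    · rfl
    · exact h1.symm
  have := hk' k
  rwa [ek, er] at this

theorem Step.exists_num_add_one {c : ℕ} {m : Step c} (hm : m ≠ .base) :
    ∃ m' : Step c, m.num = m'.num + 1 := by
  cases m with
  | base => exact absurd rfl hm
  | fork t =>
    by_cases h : t.1 = 0
    · exact ⟨.base, by simp [num, h]⟩
    · exact ⟨.merge ⟨t.1 - 1, by omega⟩, by simp only [num]; omega⟩
  | merge t => exact ⟨.fork t, rfl⟩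

/-- Every outer bend of the pattern is mapped to the corresponding outer bend of the staircase that
contains the image of the base, or of a bypass of it. -/
theorem outer_of_base {v c : ℕ} {Φ : Formula v c}
    {g : PatternElement v c (anchorLength Φ) → TextElement Φ}
    (hgx : ∀ p q, patternColumn p < patternColumn q → textColumn Φ (g p) < textColumn Φ (g q))
    (hgy : ∀ p q, patternRow p < patternRow q → textRow Φ (g p) < textRow Φ (g q))
    {i : Fin v} {s : Literal v}
    (h : ∀ k, TextElement.Is (g (.inl ⟨i, .base, .outer, k⟩)) ⟨s, .base, .outer, .main, k⟩) :
    ∀ (n : ℕ) (m : Step c), m.num = n →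
      ∃ r, ∀ k, TextElement.Is (g (.inl ⟨i, m, .outer, k⟩)) ⟨s, m, .outer, r, k⟩ := by
  intro n
  induction n with
  | zero => exact fun m hm => absurd hm m.num_pos.ne'
  | succ n ih =>
    intro m hm
    by_cases hb : m = .base
    · subst hb
      exact ⟨.main, h⟩
    · obtain ⟨m', hm'⟩ := Step.exists_num_add_one hb
      obtain ⟨r, hr⟩ := ih m' (by omega)
      exact outer_of_inner hgx hgy hm' (inner_of_outer hgx hgy hr)

theorem satisfiable_of_contains {v c : ℕ} {Φ : Formula v c} (h : Contains (text Φ) (pattern Φ)) :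
    Satisfiable Φ := by
  obtain ⟨g, hgx, hgy⟩ := exists_map_of_contains_permOfPoints h
  obtain ⟨φ, hφ⟩ := exists_assignment hgx hgy
  refine ⟨φ, fun t => ?_⟩
  choose r hr using fun i => outer_of_base hgx hgy (hφ i) _ (.fork t) rfl
  refine Clause.holds_of_monotone (r := r) (fun i => hasCopy_of_present_fork (hr i .lo).1)
    fun i j hij => ?_
  have := hgy (.inl ⟨i, .fork t, .outer, .lo⟩) (.inl ⟨j, .fork t, .outer, .lo⟩)
    (by simp [patternRow, XElement.row, coord_lt_iff, hij])
  rw [(hr i .lo).row, (hr j .lo).row] at this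
  simp only [Candidate.row, rowLevel, coord_lt_iff] at this
  omega

end PermPattern

theorem mainTheorem6 (v c : ℕ) (Φ : PermPattern.Formula v c) :
    PermPattern.Avoids (PermPattern.pattern Φ) (PermPattern.decreasing 3) ∧
    PermPattern.Avoids (PermPattern.text Φ) (PermPattern.decreasing 4) ∧
    (PermPattern.Satisfiable Φ ↔
      PermPattern.Contains (PermPattern.text Φ) (PermPattern.pattern Φ)) :=
  ⟨PermPattern.pattern_avoids Φ, PermPattern.text_avoids Φ,
    PermPattern.contains_of_satisfiable, PermPattern.satisfiable_of_contains⟩
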